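/- Let $d \ge 1$ and let $\{A_{i,n} : 1 \le i \le n,\ n \in \mathbb{N}\} \subseteq M_d(\mathbb{C})$ be a triangular array of complex $d \times d$ matrices, where $M_d(\mathbb{C})$ carries the operator norm induced by the Euclidean norm on $\mathbb{C}^d$. Denote $$A_n = \frac1n \sum_{i=1}^n A_{i,n}, \qquad L^1_n = \frac1n \sum_{i=1}^n \|A_{i,n}\|, \qquad L^\infty_n = \max_{1 \le i \le n} \|A_{i,n}\|.$$ Let $(a_n)$ be a sequence of positive integers, $b_n = \lfloor n/a_n \rfloor$, and for $1 \le j \le b_n$ let $$V_{j,n} = \{(j-1)a_n + 1, \dots, (j-1)a_n + a_n\}.$$ Then for every $n \ge 1$ and every $\varepsilon$ with $0 < \varepsilon < 3 L^1_n$, if the permutation $\sigma \in S(n)$ is drawn uniformly at random, $$\mathbb{P}\left(\exists j,\ 1 \le j \le b_n : \left\| \frac{1}{a_n} \sum_{i \in V_{j,n}} A_{\sigma(i),n} - A_n \right\| > \varepsilon \right) \le 2\, d\, b_n \exp\left( - \frac{a_n \varepsilon^2}{12\, L^1_n L^\infty_n} \right).$$ -/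

import Mathlib

/- `Matrix (Fin d) (Fin d) ℂ` carries the operator norm induced by the Euclidean norm of `ℂ^d`. -/
open scoped Matrix.Norms.L2Operator

namespace RandomPerm

/-- The symmetric group `S(n)` carries the discrete sigma-algebra. -/
instance instMeasurableSpacePerm (n : ℕ) : MeasurableSpace (Equiv.Perm (Fin n)) := ⊤

/-- The uniform probability distribution on the symmetric group `S(n)`. -/
noncomputable def uniformPerm (n : ℕ) : MeasureTheory.Measure (Equiv.Perm (Fin n)) :=
  (PMF.uniformOfFintype (Equiv.Perm (Fin n))).toMeasure

/-- A triangular array `A_{i,n}` of complex `d × d` matrices: row `n` has `n` entries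
(indexed by `0, …, n - 1`). -/
abbrev TriArray (d : ℕ) : Type := (n : ℕ) → Fin n → Matrix (Fin d) (Fin d) ℂ

/-- The row average `A_n = (1/n) ∑ i, A_{i,n}`. -/
noncomputable def rowAvg {d : ℕ} (A : TriArray d) (n : ℕ) : Matrix (Fin d) (Fin d) ℂ :=
  (1 / (n : ℂ)) • ∑ i, A n i

/-- `L¹_n = (1/n) ∑ i, ‖A_{i,n}‖`. -/
noncomputable def LOne {d : ℕ} (A : TriArray d) (n : ℕ) : ℝ :=
  (1 / (n : ℝ)) * ∑ i, ‖A n i‖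

/-- `L^∞_n = max_i ‖A_{i,n}‖` (a supremum over a finite family). -/
noncomputable def LInf {d : ℕ} (A : TriArray d) (n : ℕ) : ℝ :=
  ⨆ i, ‖A n i‖

/-- The number of blocks `b_n = [n / a_n]` for the block length `a = a_n`. -/
def numBlocks (a n : ℕ) : ℕ := n / a

/-- The `j`-th block of `a` consecutive indices; with indices and blocks counted from `0` it is
`{j a, …, j a + a - 1}`. -/
def block (a n j : ℕ) : Finset (Fin n) :=
  Finset.univ.filter fun i => j * a ≤ (i : ℕ) ∧ (i : ℕ) < j * a + a

/-- The permuted block average `(1/a) ∑_{i ∈ V_j} A_{σ(i),n}` over the `j`-th block. -/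
noncomputable def blockAvg {d : ℕ} (A : TriArray d) (a n j : ℕ) (σ : Equiv.Perm (Fin n)) :
    Matrix (Fin d) (Fin d) ℂ :=
  (1 / (a : ℂ)) • ∑ i ∈ block a n j, A n (σ i)

end RandomPerm

/-! A union bound over the blocks leaves one block. There the Hermitian dilation turns the norm of
the deviation into an eigenvalue, so the trace of a matrix exponential dominates the exponential of
the norm, and Markov's inequality applies.

A block of a random permutation is a sample without replacement. As `K ↦ tr exp K` is convex
(`convexOn_trace_exp`), Hoeffding's comparison (`card_pow_mul_sum_perm_le`) bounds its exponential
moment by that of independent samples. Golden–Thompson then peels these off one at a time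
(`sum_trace_exp_sum_re_le`), each costing a Bernstein factor `exp (θ² v)` with `v = L¹ L^∞`, because
`‖A_i‖² ≤ ‖A_i‖ L^∞`. Taking `θ = ε / (6 v)` gives the bound; the factor `2 d` is the dimension of
the dilation. -/

namespace RandomPerm

open scoped MatrixOrder ComplexOrder
open Matrix NormedSpace Filter Topology

/-! ### Trace inequalities for powers of products -/

section Trace

variable {m : Type*} [Fintype m]

theorem two_mul_trace_re_le (A B : Matrix m m ℂ) :
    2 * (trace (Aᴴ * B)).re ≤ (trace (Aᴴ * A)).re + (trace (Bᴴ * B)).re := by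
  have h := (Complex.nonneg_iff.mp
    (posSemidef_conjTranspose_mul_self (A - B)).trace_nonneg).1
  have hs : (trace (Bᴴ * A)).re = (trace (Aᴴ * B)).re := by
    rw [← conjTranspose_conjTranspose (Bᴴ * A), trace_conjTranspose]
    simp [conjTranspose_mul]
  simp only [conjTranspose_sub, sub_mul, mul_sub, trace_sub, Complex.sub_re, hs] at h
  linarith

variable [DecidableEq m]

theorem trace_mul_re_nonneg {P Q : Matrix m m ℂ} (hP : 0 ≤ P) (hQ : 0 ≤ Q) :
    0 ≤ (trace (P * Q)).re := by
  obtain ⟨C, rfl⟩ := CStarAlgebra.nonneg_iff_eq_star_mul_self.mp hQ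
  rw [star_eq_conjTranspose, ← mul_assoc, trace_mul_comm, ← mul_assoc]
  exact (Complex.nonneg_iff.mp
    (hP.posSemidef.mul_mul_conjTranspose_same C).trace_nonneg).1

theorem trace_mul_re_le {P Q : Matrix m m ℂ} {c : ℝ} (hP : 0 ≤ P)
    (hQ : Q ≤ algebraMap ℝ _ c) : (trace (P * Q)).re ≤ c * (trace P).re := by
  have h := trace_mul_re_nonneg hP (sub_nonneg.mpr hQ)
  rw [mul_sub, trace_sub, Algebra.algebraMap_eq_smul_one, mul_smul_comm, mul_one,
    trace_smul, Complex.sub_re, Complex.smul_re, smul_eq_mul] at h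
  linarith

theorem trace_mul_pow_comm (A B : Matrix m m ℂ) (k : ℕ) :
    trace ((A * B) ^ k) = trace ((B * A) ^ k) := by
  cases k with
  | zero => simp
  | succ k =>
    have h : SemiconjBy B (A * B) (B * A) := by simp [SemiconjBy, mul_assoc]
    rw [pow_succ', mul_assoc, trace_mul_comm, (h.pow_right k).eq, mul_assoc, ← pow_succ]

/-- The two bounds feed each other in one induction. The second, at powers `2 ^ k`, is what
Golden–Thompson needs before passing to the limit. -/
theorem trace_pow_two_pow_re_le (k : ℕ) :
    (∀ M : Matrix m m ℂ, (trace (M ^ 2 ^ (k + 1))).re ≤ (trace ((Mᴴ * M) ^ 2 ^ k)).re) ∧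
    (∀ X Y : Matrix m m ℂ, X.IsHermitian → Y.IsHermitian →
      (trace ((X * Y) ^ 2 ^ k)).re ≤ (trace (X ^ 2 ^ k * Y ^ 2 ^ k)).re) := by
  induction k with
  | zero =>
    refine ⟨fun M => ?_, fun X Y _ _ => by simp⟩
    have h := two_mul_trace_re_le Mᴴ M
    rw [conjTranspose_conjTranspose, trace_mul_comm M Mᴴ] at h
    simp only [zero_add, pow_one, pow_zero, sq]
    linarith
  | succ k ih =>
    obtain ⟨ihM, ihXY⟩ := ih
    constructor
    · intro M
      have hX : (Mᴴ * M).IsHermitian := isHermitian_conjTranspose_mul_self M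
      have hY : (M * Mᴴ).IsHermitian := isHermitian_mul_conjTranspose_self M
      -- By cyclicity the bound for `M ^ 2` involves the product of `Mᴴ * M` and `M * Mᴴ`. The
      -- second bound separates them, and `2 Re tr (AᴴB) ≤ tr (AᴴA) + tr (BᴴB)` finishes, as both
      -- have the same power traces.
      have h1 := ihM (M ^ 2)
      rw [← pow_mul, ← pow_succ'] at h1
      have h2 : (M ^ 2)ᴴ * M ^ 2 = Mᴴ * ((Mᴴ * M) * M) := by
        simp only [sq, conjTranspose_mul, mul_assoc]
      rw [h2, trace_mul_pow_comm, mul_assoc] at h1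
      have h3 := ihXY _ _ hX hY
      have h4 := two_mul_trace_re_le ((Mᴴ * M) ^ 2 ^ k) ((M * Mᴴ) ^ 2 ^ k)
      rw [(hX.pow _).eq, (hY.pow _).eq, ← pow_add, ← pow_add, ← two_mul, ← pow_succ',
        trace_mul_pow_comm M Mᴴ] at h4
      linarith
    · intro X Y hX hY
      have h1 := ihM (X * Y)
      have h2 : (X * Y)ᴴ * (X * Y) = Y * (X ^ 2 * Y) := by
        simp only [sq, conjTranspose_mul, mul_assoc, hX.eq, hY.eq]
      rw [h2, trace_mul_pow_comm Y, mul_assoc, ← sq] at h1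
      have h3 := ihXY _ _ (hX.pow 2) (hY.pow 2)
      rw [← pow_mul, ← pow_mul, ← pow_succ'] at h3
      exact h1.trans h3

end Trace

/-! ### The Lie–Trotter formula -/

section LieTrotter

variable {𝔸 : Type*} [NormedRing 𝔸] [NormOneClass 𝔸]

theorem norm_pow_sub_pow_le {x y : 𝔸} {c : ℝ} (hx : ‖x‖ ≤ c) (hy : ‖y‖ ≤ c) (n : ℕ) :
    ‖x ^ (n + 1) - y ^ (n + 1)‖ ≤ (n + 1) * c ^ n * ‖x - y‖ := by
  have hc : 0 ≤ c := (norm_nonneg x).trans hx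
  induction n with
  | zero => simp
  | succ n ih =>
    have h : x ^ (n + 1 + 1) - y ^ (n + 1 + 1) =
        x * (x ^ (n + 1) - y ^ (n + 1)) + (x - y) * y ^ (n + 1) := by
      rw [pow_succ' x (n + 1), pow_succ' y (n + 1)]; noncomm_ring
    rw [h]
    calc _ ≤ ‖x‖ * ‖x ^ (n + 1) - y ^ (n + 1)‖ + ‖x - y‖ * ‖y‖ ^ (n + 1) := by
          refine (norm_add_le _ _).trans ?_
          gcongr
          · exact norm_mul_le _ _
          · exact (norm_mul_le _ _).trans (by gcongr; exact norm_pow_le _ _)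
      _ ≤ c * ((n + 1) * c ^ n * ‖x - y‖) + ‖x - y‖ * c ^ (n + 1) := by gcongr
      _ = _ := by push_cast; ring

variable [NormedAlgebra ℝ 𝔸]

theorem norm_exp_le (x : 𝔸) : ‖exp x‖ ≤ Real.exp ‖x‖ := by
  rw [exp_eq_tsum ℝ, Real.exp_eq_exp_ℝ, exp_eq_tsum ℝ]
  refine tsum_of_norm_bounded (NormedSpace.expSeries_summable' (𝕂 := ℝ) ‖x‖).hasSum fun n => ?_
  rw [norm_smul, smul_eq_mul, Real.norm_of_nonneg (by positivity)]
  gcongr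
  exact norm_pow_le _ _

variable [CompleteSpace 𝔸]

/-- The Lie–Trotter product formula. -/
theorem tendsto_exp_mul_exp_pow (A B : 𝔸) :
    Tendsto (fun n : ℕ => (exp ((1 / ((n : ℝ) + 1)) • A) * exp ((1 / ((n : ℝ) + 1)) • B)) ^ (n + 1))
      atTop (𝓝 (exp (A + B))) := by
  -- Both exponentials agree to first order, so their difference is `o(t)`; telescoping the powers
  -- loses only a factor of order `1 / t = n + 1`.
  have hd : HasDerivAt (fun t : ℝ => exp (t • A) * exp (t • B) - exp (t • (A + B))) 0 0 := by
    have h := ((hasDerivAt_exp_smul_const A (0 : ℝ)).mul (hasDerivAt_exp_smul_const B (0 : ℝ))).sub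
      (hasDerivAt_exp_smul_const (A + B) (0 : ℝ))
    simp only [zero_smul, exp_zero, one_mul, mul_one, sub_self] at h
    exact h
  rw [hasDerivAt_iff_tendsto_slope_zero] at hd
  have hn : Tendsto (fun n : ℕ => 1 / ((n : ℝ) + 1)) atTop (𝓝[≠] 0) :=
    tendsto_nhdsWithin_iff.mpr ⟨tendsto_one_div_add_atTop_nhds_zero_nat,
      Eventually.of_forall fun n => by
        simp only [Set.mem_compl_iff, Set.mem_singleton_iff]; positivity⟩
  have h0 := (hd.comp hn).norm.const_mul (Real.exp (‖A‖ + ‖B‖))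
  rw [norm_zero, mul_zero] at h0
  rw [tendsto_iff_norm_sub_tendsto_zero]
  refine squeeze_zero (fun _ => norm_nonneg _) (fun n => ?_) h0
  set t : ℝ := 1 / ((n : ℝ) + 1) with ht
  have ht0 : 0 < t := by positivity
  have htn : ((n + 1 : ℕ) : ℝ) * t = 1 := by rw [ht]; push_cast; field_simp
  have he : exp (A + B) = exp (t • (A + B)) ^ (n + 1) := by
    let _ : NormedAlgebra ℚ 𝔸 := .restrictScalars ℚ ℝ 𝔸
    rw [← NormedSpace.exp_nsmul, ← Nat.cast_smul_eq_nsmul ℝ, smul_smul, htn, one_smul]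
  set c := Real.exp (t * (‖A‖ + ‖B‖)) with hc
  have hx : ‖exp (t • A) * exp (t • B)‖ ≤ c := by
    refine (norm_mul_le _ _).trans ?_
    rw [hc, mul_add, Real.exp_add]
    gcongr
    · exact (norm_exp_le _).trans_eq (by rw [norm_smul, Real.norm_of_nonneg ht0.le])
    · exact (norm_exp_le _).trans_eq (by rw [norm_smul, Real.norm_of_nonneg ht0.le])
  have hy : ‖exp (t • (A + B))‖ ≤ c := by
    refine (norm_exp_le _).trans ?_
    rw [hc, norm_smul, Real.norm_of_nonneg ht0.le]
    gcongr
    exact norm_add_le _ _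
  have h := norm_pow_sub_pow_le hx hy n
  rw [he]
  refine h.trans ?_
  have hcn : c ^ n ≤ Real.exp (‖A‖ + ‖B‖) := by
    rw [hc, ← Real.exp_nat_mul, ← mul_assoc]
    refine Real.exp_le_exp.mpr (mul_le_of_le_one_left (by positivity) ?_)
    rw [← htn]; push_cast; gcongr; linarith
  have hti : ‖t⁻¹‖ = n + 1 := by rw [norm_inv, Real.norm_of_nonneg ht0.le, ht]; simp
  simp only [Function.comp_apply, zero_add, ← ht, zero_smul, exp_zero, mul_one, sub_self, sub_zero,
    norm_smul, hti]
  calc _ ≤ (n + 1) * Real.exp (‖A‖ + ‖B‖) * ‖exp (t • A) * exp (t • B) - exp (t • (A + B))‖ := by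
        gcongr
    _ = _ := by ring

end LieTrotter

/-! ### The Golden–Thompson inequality -/

section GoldenThompson

variable {m : Type*}

theorem continuous_trace_re [Fintype m] : Continuous fun M : Matrix m m ℂ => (trace M).re :=
  Complex.continuous_re.comp (continuous_id.matrix_trace)

theorem isHermitian_real_smul {A : Matrix m m ℂ} (hA : A.IsHermitian) (t : ℝ) :
    (t • A).IsHermitian := by
  rw [IsHermitian, conjTranspose_smul, hA.eq, star_trivial]

variable [Fintype m] [DecidableEq m]

/-- The Golden–Thompson inequality. -/
theorem trace_exp_add_re_le {A B : Matrix m m ℂ} (hA : A.IsHermitian) (hB : B.IsHermitian) :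
    (trace (exp (A + B))).re ≤ (trace (exp A * exp B)).re := by
  cases isEmpty_or_nonempty m with
  | inl h => simp [trace]
  | inr h =>
    have h2 : Tendsto (fun k : ℕ => 2 ^ k - 1) atTop atTop :=
      tendsto_atTop_mono (fun k => Nat.le_sub_one_of_lt Nat.lt_two_pow_self) tendsto_id
    have hl := (continuous_trace_re.tendsto _).comp ((tendsto_exp_mul_exp_pow A B).comp h2)
    refine le_of_tendsto hl (Eventually.of_forall fun k => ?_)
    have hk : 2 ^ k - 1 + 1 = 2 ^ k := Nat.sub_add_cancel Nat.one_le_two_pow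
    have hk' : ((2 ^ k - 1 : ℕ) : ℝ) + 1 = (2 ^ k : ℕ) := by exact_mod_cast hk
    have hs (C : Matrix m m ℂ) : exp ((1 / ((2 ^ k : ℕ) : ℝ)) • C) ^ 2 ^ k = exp C := by
      rw [← Matrix.exp_nsmul, ← Nat.cast_smul_eq_nsmul ℝ, smul_smul, mul_one_div_cancel, one_smul]
      positivity
    have := (trace_pow_two_pow_re_le k).2 _ _
      (isHermitian_real_smul hA (1 / ((2 ^ k : ℕ) : ℝ))).exp
      (isHermitian_real_smul hB (1 / ((2 ^ k : ℕ) : ℝ))).exp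
    rw [hs, hs] at this
    simpa only [Function.comp_apply, hk, hk'] using this

end GoldenThompson

/-! ### Operator inequalities for the exponential -/

section ExpOrder

variable {m : Type*} [Fintype m] [DecidableEq m]

theorem one_add_le_exp {K : Matrix m m ℂ} (hK : K.IsHermitian) : 1 + K ≤ exp K := by
  have hK' : IsSelfAdjoint K := hK
  rw [← CFC.real_exp_eq_normedSpace_exp hK']
  have h : 1 + K = cfc (fun x : ℝ => 1 + x) K := by
    rw [cfc_add .., cfc_const_one .., cfc_id' ..]
  rw [h]
  exact cfc_mono (fun x _ => by linarith [Real.add_one_le_exp x])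

theorem exp_nonneg {K : Matrix m m ℂ} (hK : K.IsHermitian) : 0 ≤ exp K := by
  have hK' : IsSelfAdjoint K := hK
  rw [← CFC.real_exp_eq_normedSpace_exp hK']
  exact cfc_nonneg fun x _ => (Real.exp_pos x).le

theorem exp_le_one_add_add_sq {K : Matrix m m ℂ} (hK : K.IsHermitian) (h1 : ‖K‖ ≤ 1) :
    exp K ≤ 1 + K + K ^ 2 := by
  have hK' : IsSelfAdjoint K := hK
  rw [← CFC.real_exp_eq_normedSpace_exp hK']
  have h : 1 + K + K ^ 2 = cfc (fun x : ℝ => 1 + x + x ^ 2) K := by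
    rw [cfc_add .., cfc_add .., cfc_const_one .., cfc_id' .., cfc_pow_id ..]
  rw [h]
  refine cfc_mono fun x hx => ?_
  have hx1 : |x| ≤ 1 := by
    cases isEmpty_or_nonempty m with
    | inl h => simp [Subsingleton.elim K 0] at hx
    | inr h => exact (spectrum.norm_le_norm_of_mem hx).trans h1
  have := (abs_le.mp (Real.abs_exp_sub_one_sub_id_le hx1)).2
  linarith

end ExpOrder

/-! ### Convexity of the trace exponential -/

section Convexity

variable {m : Type*} [Fintype m] [DecidableEq m]

/-- The Peierls inequality for a standard basis vector. -/
theorem exp_diag_re_le {K : Matrix m m ℂ} (hK : K.IsHermitian) (i : m) :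
    Real.exp (K i i).re ≤ (exp K i i).re := by
  set c := (K i i).re with hc
  have hS : (algebraMap ℝ (Matrix m m ℂ) (-c)).IsHermitian :=
    (IsSelfAdjoint.all (-c)).algebraMap _
  -- Shifting by `-c` makes the `i`-th diagonal entry have real part zero, so `1 + K ≤ exp K`
  -- becomes the tangent line bound at `c`.
  have h := (sub_nonneg.mpr (one_add_le_exp (hK.add hS))).posSemidef.diag_nonneg (i := i)
  have he : exp (K + algebraMap ℝ (Matrix m m ℂ) (-c)) = Real.exp (-c) • exp K := by
    rw [Matrix.exp_add_of_commute _ _ (Algebra.commute_algebraMap_right _ _),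
      ← algebraMap_exp_comm, ← Real.exp_eq_exp_ℝ, Algebra.algebraMap_eq_smul_one, mul_smul_comm,
      mul_one]
  rw [he] at h
  have h' := (Complex.nonneg_iff.mp h).1
  simp only [Matrix.sub_apply, Matrix.add_apply, Matrix.smul_apply, one_apply_eq, Complex.sub_re, Complex.add_re,
    Complex.smul_re, Complex.one_re, Algebra.algebraMap_eq_smul_one, smul_eq_mul, ← hc] at h'
  have h2 : 1 ≤ Real.exp (-c) * (exp K i i).re := by linarith
  calc Real.exp c ≤ Real.exp c * (Real.exp (-c) * (exp K i i).re) :=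
        le_mul_of_one_le_right (Real.exp_pos c).le h2
    _ = _ := by rw [← mul_assoc, ← Real.exp_add]; simp

theorem trace_exp_eq_sum_conj {V : Matrix m m ℂ} (hV : V * star V = 1) (K : Matrix m m ℂ) :
    trace (exp K) = ∑ i, exp (star V * K * V) i i := by
  have h := Matrix.exp_conj' V K (.of_mul_eq_one _ hV)
  rw [inv_eq_right_inv hV] at h
  change _ = trace (exp (star V * K * V))
  rw [h, trace_mul_cycle, hV, one_mul]

theorem star_mul_mul_eigenvectorUnitary {H : Matrix m m ℂ} (hH : H.IsHermitian) :
    star (hH.eigenvectorUnitary : Matrix m m ℂ) * H * hH.eigenvectorUnitary =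
      diagonal fun i => (hH.eigenvalues i : ℂ) := by
  have := hH.conjStarAlgAut_star_eigenvectorUnitary
  rw [Unitary.conjStarAlgAut_star_apply] at this
  exact this

theorem exp_conj_eigenvectorUnitary_diag_re {H : Matrix m m ℂ} (hH : H.IsHermitian) (i : m) :
    (exp (star (hH.eigenvectorUnitary : Matrix m m ℂ) * H * hH.eigenvectorUnitary) i i).re =
      Real.exp (hH.eigenvalues i) := by
  rw [star_mul_mul_eigenvectorUnitary, Matrix.exp_diagonal, diagonal_apply_eq, Pi.coe_exp,
    ← Complex.exp_eq_exp_ℂ, Complex.exp_ofReal_re]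

theorem trace_exp_re_eq_sum {H : Matrix m m ℂ} (hH : H.IsHermitian) :
    (trace (exp H)).re = ∑ i, Real.exp (hH.eigenvalues i) := by
  rw [trace_exp_eq_sum_conj (Unitary.coe_mul_star_self hH.eigenvectorUnitary), Complex.re_sum]
  exact Finset.sum_congr rfl fun i _ => exp_conj_eigenvectorUnitary_diag_re hH i

/-- In an eigenbasis of the combination, its eigenvalues are the same combinations of the diagonal
entries of `A` and `B`. Scalar convexity of `exp` and the Peierls inequality then apply entry by
entry. -/
theorem convexOn_trace_exp :
    ConvexOn ℝ {K : Matrix m m ℂ | K.IsHermitian} fun K => (trace (exp K)).re := by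
  refine ⟨fun A hA B hB s t _ _ _ => (isHermitian_real_smul hA s).add (isHermitian_real_smul hB t),
    fun A hA B hB s t hs ht hst => ?_⟩
  have hH : (s • A + t • B).IsHermitian :=
    (isHermitian_real_smul hA s).add (isHermitian_real_smul hB t)
  set V : Matrix m m ℂ := ↑hH.eigenvectorUnitary with hV
  have hVV : V * star V = 1 := Unitary.coe_mul_star_self hH.eigenvectorUnitary
  have hherm {K : Matrix m m ℂ} (hK : K.IsHermitian) : (star V * K * V).IsHermitian :=
    isHermitian_conjTranspose_mul_mul V hK
  have hdi (i : m) : hH.eigenvalues i =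
      s * ((star V * A * V) i i).re + t * ((star V * B * V) i i).re := by
    have := congrArg (fun M : Matrix m m ℂ => (M i i).re) (star_mul_mul_eigenvectorUnitary hH)
    rw [← hV] at this
    simpa [mul_add, add_mul] using this.symm
  simp only [trace_exp_re_eq_sum hH, trace_exp_eq_sum_conj hVV A, trace_exp_eq_sum_conj hVV B,
    Complex.re_sum, smul_eq_mul, Finset.mul_sum, ← Finset.sum_add_distrib]
  refine Finset.sum_le_sum fun i _ => ?_
  rw [hdi i]
  refine (convexOn_exp.2 (Set.mem_univ _) (Set.mem_univ _) hs ht hst).trans ?_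
  simp only [smul_eq_mul]
  gcongr
  · exact exp_diag_re_le (hherm hA) i
  · exact exp_diag_re_le (hherm hB) i

end Convexity

/-! ### Exponential moments for independent samples -/

section IndependentSampling

variable {m : Type*} {ι : Type*} [Fintype ι]

theorem isHermitian_sum {κ : Type*} (s : Finset κ) {Y : κ → Matrix m m ℂ}
    (hY : ∀ i, (Y i).IsHermitian) : (∑ i ∈ s, Y i).IsHermitian := by
  rw [IsHermitian, conjTranspose_sum]
  exact Finset.sum_congr rfl fun i _ => hY i

variable [Fintype m] [DecidableEq m]

/-- The Ahlswede–Winter bound for sums of independent uniform samples. -/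
theorem sum_trace_exp_sum_re_le {Y : ι → Matrix m m ℂ} (hY : ∀ i, (Y i).IsHermitian) {c : ℝ}
    (hc : 0 ≤ c) (h : ∑ i, exp (Y i) ≤ algebraMap ℝ _ c) (k : ℕ) :
    ∑ f : Fin k → ι, (trace (exp (∑ j, Y (f j)))).re ≤ Fintype.card m * c ^ k := by
  induction k with
  | zero => simp
  | succ k ih =>
    rw [← (Fin.consEquiv fun _ => ι).sum_comp, Fintype.sum_prod_type, Finset.sum_comm]
    simp only [Fin.consEquiv_apply, Fin.sum_univ_succ, Fin.cons_zero, Fin.cons_succ]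
    calc _ ≤ ∑ f : Fin k → ι, ∑ i, (trace (exp (∑ j, Y (f j)) * exp (Y i))).re := by
          refine Finset.sum_le_sum fun f _ => Finset.sum_le_sum fun i _ => ?_
          rw [add_comm]
          exact trace_exp_add_re_le (isHermitian_sum _ fun j => hY (f j)) (hY i)
      _ ≤ ∑ f : Fin k → ι, c * (trace (exp (∑ j, Y (f j)))).re := by
          refine Finset.sum_le_sum fun f _ => ?_
          rw [← Complex.re_sum, ← trace_sum, ← Finset.mul_sum]
          exact trace_mul_re_le (exp_nonneg (isHermitian_sum _ fun j => hY (f j))) h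
      _ ≤ c * (Fintype.card m * c ^ k) := by rw [← Finset.mul_sum]; gcongr
      _ = _ := by ring

/-- Bernstein's bound on the matrix moment generating function of a centred uniform sample. -/
theorem sum_exp_le {Y : ι → Matrix m m ℂ} (hY : ∀ i, (Y i).IsHermitian)
    (h1 : ∀ i, ‖Y i‖ ≤ 1) (h0 : ∑ i, Y i = 0) {v : ℝ}
    (hv : ∑ i, Y i ^ 2 ≤ algebraMap ℝ _ (Fintype.card ι * v)) :
    ∑ i, exp (Y i) ≤ algebraMap ℝ _ (Fintype.card ι * Real.exp v) := by
  calc _ ≤ ∑ i, (1 + Y i + Y i ^ 2) :=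
        Finset.sum_le_sum fun i _ => exp_le_one_add_add_sq (hY i) (h1 i)
    _ = algebraMap ℝ _ (Fintype.card ι) + ∑ i, Y i ^ 2 := by
        simp [Finset.sum_add_distrib, h0]
    _ ≤ algebraMap ℝ _ (Fintype.card ι) + algebraMap ℝ _ (Fintype.card ι * v) := by gcongr
    _ ≤ _ := by
        rw [← map_add]
        refine algebraMap_mono _ ?_
        nlinarith [Real.add_one_le_exp v, (Nat.cast_nonneg (Fintype.card ι) : (0 : ℝ) ≤ _)]

end IndependentSampling

/-! ### Sampling without versus with replacement -/

section Hoeffding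

variable {ι : Type*} [Fintype ι] [DecidableEq ι] {E : Type*} [AddCommGroup E] [Module ℝ E]

/-- The image of `f` has at most `a` points, so some permutation moves it into the range of `B`. -/
theorem exists_perm_comp_eq {a : ℕ} (B : Fin a ↪ ι) (f : Fin a → ι) :
    ∃ (ρ : Equiv.Perm ι) (g : Fin a → Fin a), ∀ k, ρ (f k) = B (g k) := by
  obtain ⟨t, ht, hct⟩ := Finset.exists_subset_card_eq
    (s := Finset.univ.map B) (n := (Finset.univ.image f).card)
    (by simpa using Finset.card_image_le (s := Finset.univ) (f := f))
  let e : {x // x ∈ Finset.univ.image f} ≃ {x // x ∈ t} := Finset.equivOfCardEq hct.symm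
  have hmem (k : Fin a) : ∃ l, B l = e.extendSubtype (f k) := by
    have := ht (e.extendSubtype_mem (f k) (by simp))
    simpa using this
  choose g hg using hmem
  exact ⟨e.extendSubtype, g, fun k => (hg k).symm⟩

/-- Among all index patterns `f`, the injective ones minimise the average of a convex function of
the sampled sum. -/
theorem sum_perm_convexOn_le {a : ℕ} [NeZero a] (B : Fin a ↪ ι) (f : Fin a → ι) {s : Set E}
    {φ : E → ℝ} (hφ : ConvexOn ℝ s φ) {X : ι → E} (hX : ∀ g : Fin a → ι, ∑ k, X (g k) ∈ s) :
    ∑ σ : Equiv.Perm ι, φ (∑ k, X (σ (B k))) ≤ ∑ σ : Equiv.Perm ι, φ (∑ k, X (σ (f k))) := by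
  obtain ⟨ρ, g, hg⟩ := exists_perm_comp_eq B f
  have ha : (0 : ℝ) < a := Nat.cast_pos.mpr (NeZero.pos a)
  -- Summing over all `σ` absorbs both `ρ` and a cyclic shift of the range of `B`. Averaging over
  -- shifts makes each `g k + c` run through all of `Fin a`, so Jensen recovers the injective
  -- sample.
  have hshift (c : Fin a) : ∑ σ : Equiv.Perm ι, φ (∑ k, X (σ (f k))) =
      ∑ σ : Equiv.Perm ι, φ (∑ k, X (σ (B (g k + c)))) := by
    rw [← Equiv.sum_comp (Equiv.mulRight (((Equiv.addRight c).viaFintypeEmbedding B) * ρ))]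
    simp [hg, Equiv.Perm.viaFintypeEmbedding_apply_image]
  have havg : ∑ σ : Equiv.Perm ι, φ (∑ k, X (σ (f k))) =
      ∑ σ : Equiv.Perm ι, ∑ c : Fin a, (a : ℝ)⁻¹ * φ (∑ k, X (σ (B (g k + c)))) := by
    rw [Finset.sum_comm]
    simp only [← Finset.mul_sum, ← hshift]
    simp [ha.ne']
  rw [havg]
  refine Finset.sum_le_sum fun σ _ => ?_
  have hJ := hφ.map_sum_le (t := Finset.univ) (w := fun _ : Fin a => (a : ℝ)⁻¹)
    (p := fun c => ∑ k, X (σ (B (g k + c)))) (fun _ _ => by positivity) (by simp [ha.ne'])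
    (fun c _ => hX fun k => σ (B (g k + c)))
  have hs : ∑ c : Fin a, (a : ℝ)⁻¹ • ∑ k, X (σ (B (g k + c))) = ∑ k, X (σ (B k)) := by
    rw [← Finset.smul_sum, Finset.sum_comm]
    have (k : Fin a) : ∑ c, X (σ (B (g k + c))) = ∑ c, X (σ (B c)) :=
      Equiv.sum_comp (Equiv.addLeft (g k)) fun c => X (σ (B c))
    simp only [this, Finset.sum_const, Finset.card_univ, Fintype.card_fin]
    rw [← Nat.cast_smul_eq_nsmul ℝ, smul_smul, inv_mul_cancel₀ ha.ne', one_smul]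
  rw [hs] at hJ
  simpa only [smul_eq_mul] using hJ

/-- Hoeffding's comparison of sampling without and with replacement. -/
theorem card_pow_mul_sum_perm_le {a : ℕ} [NeZero a] (B : Fin a ↪ ι) {s : Set E}
    {φ : E → ℝ} (hφ : ConvexOn ℝ s φ) {X : ι → E} (hX : ∀ g : Fin a → ι, ∑ k, X (g k) ∈ s) :
    (Fintype.card ι : ℝ) ^ a * ∑ σ : Equiv.Perm ι, φ (∑ k, X (σ (B k))) ≤
      (Fintype.card (Equiv.Perm ι) : ℝ) * ∑ f : Fin a → ι, φ (∑ k, X (f k)) := by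
  calc _ = ∑ _f : Fin a → ι, ∑ σ : Equiv.Perm ι, φ (∑ k, X (σ (B k))) := by simp
    _ ≤ ∑ f : Fin a → ι, ∑ σ : Equiv.Perm ι, φ (∑ k, X (σ (f k))) :=
        Finset.sum_le_sum fun f _ => sum_perm_convexOn_le B f hφ hX
    _ = ∑ σ : Equiv.Perm ι, ∑ f : Fin a → ι, φ (∑ k, X (f k)) := by
        rw [Finset.sum_comm]
        refine Finset.sum_congr rfl fun σ _ => ?_
        exact (Equiv.arrowCongr (Equiv.refl (Fin a)) σ).sum_comp fun f => φ (∑ k, X (f k))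
    _ = _ := by simp

end Hoeffding
-- Hermitian dilation and the operator norm
section Dilation

variable {m : Type*}

/-- The Hermitian dilation of a square matrix, as a real-linear map. -/
def dilation : Matrix m m ℂ →ₗ[ℝ] Matrix (m ⊕ m) (m ⊕ m) ℂ where
  toFun M := fromBlocks 0 M Mᴴ 0
  map_add' M N := by simp [fromBlocks_add]
  map_smul' r M := by simp [fromBlocks_smul, conjTranspose_smul]

theorem dilation_apply (M : Matrix m m ℂ) : dilation M = fromBlocks 0 M Mᴴ 0 := rfl

theorem isHermitian_dilation (M : Matrix m m ℂ) : (dilation M).IsHermitian := by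
  simp [IsHermitian, dilation_apply, fromBlocks_conjTranspose]

variable [Fintype m] [DecidableEq m]

theorem fromBlocks_diag_nonneg {P Q : Matrix m m ℂ} (hP : 0 ≤ P) (hQ : 0 ≤ Q) :
    0 ≤ fromBlocks P 0 0 Q := by
  obtain ⟨C, rfl⟩ := CStarAlgebra.nonneg_iff_eq_star_mul_self.mp hP
  obtain ⟨D, rfl⟩ := CStarAlgebra.nonneg_iff_eq_star_mul_self.mp hQ
  refine CStarAlgebra.nonneg_iff_eq_star_mul_self.mpr ⟨fromBlocks C 0 0 D, ?_⟩
  simp [star_eq_conjTranspose, fromBlocks_conjTranspose, fromBlocks_multiply]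

/-- The square is block diagonal with blocks `M * Mᴴ` and `Mᴴ * M`. -/
theorem dilation_sq_le (M : Matrix m m ℂ) : dilation M ^ 2 ≤ algebraMap ℝ _ (‖M‖ ^ 2) := by
  rw [← sub_nonneg]
  have h : algebraMap ℝ (Matrix (m ⊕ m) (m ⊕ m) ℂ) (‖M‖ ^ 2) - dilation M ^ 2 =
      fromBlocks (algebraMap ℝ _ (‖M‖ ^ 2) - M * star M) 0 0
        (algebraMap ℝ _ (‖M‖ ^ 2) - star M * M) := by
    rw [sq (dilation M), dilation_apply, fromBlocks_multiply]
    simp only [Algebra.algebraMap_eq_smul_one, ← fromBlocks_one, fromBlocks_smul, sub_eq_add_neg,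
      fromBlocks_neg, fromBlocks_add]
    simp [star_eq_conjTranspose]
  rw [h]
  exact fromBlocks_diag_nonneg (sub_nonneg.mpr CStarAlgebra.mul_star_le_algebraMap_norm_sq)
    (sub_nonneg.mpr CStarAlgebra.star_mul_le_algebraMap_norm_sq)

theorem norm_dilation_le (M : Matrix m m ℂ) : ‖dilation M‖ ≤ ‖M‖ := by
  have hs : star (dilation M) = dilation M := isHermitian_dilation M
  have h0 : 0 ≤ dilation M ^ 2 := by
    rw [sq]; nth_rw 1 [← hs]; exact star_mul_self_nonneg _
  have h := (CStarAlgebra.norm_le_iff_le_algebraMap _ (sq_nonneg ‖M‖) h0).mpr (dilation_sq_le M)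
  rw [sq (dilation M)] at h
  nth_rw 1 [← hs] at h
  rw [CStarRing.norm_star_mul_self, ← sq] at h
  exact (sq_le_sq₀ (norm_nonneg _) (norm_nonneg _)).mp h

theorem mem_spectrum_of_mulVec_eq {K : Matrix m m ℂ} {r : ℝ} {w : m → ℂ} (hw : w ≠ 0)
    (h : K *ᵥ w = r • w) : r ∈ spectrum ℝ K := by
  intro hu
  refine hw (mulVec_injective_of_isUnit hu ?_)
  rw [sub_mulVec, h, Algebra.algebraMap_eq_smul_one, smul_mulVec, one_mulVec, sub_self,
    mulVec_zero]

theorem exp_le_trace_exp {K : Matrix m m ℂ} (hK : K.IsHermitian) {r : ℝ}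
    (hr : r ∈ spectrum ℝ K) : Real.exp r ≤ (trace (exp K)).re := by
  rw [hK.spectrum_real_eq_range_eigenvalues] at hr
  obtain ⟨i, rfl⟩ := hr
  rw [trace_exp_re_eq_sum hK]
  exact Finset.single_le_sum (f := fun i => Real.exp (hK.eigenvalues i))
    (fun i _ => (Real.exp_pos _).le) (Finset.mem_univ i)

theorem norm_mem_spectrum_dilation {M : Matrix m m ℂ} (hM : 0 < ‖M‖) :
    ‖M‖ ∈ spectrum ℝ (dilation M) := by
  have : Nonempty m := by
    by_contra h
    rw [not_nonempty_iff] at h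
    simp [Subsingleton.elim M 0] at hM
  have hH : (Mᴴ * M).IsHermitian := isHermitian_conjTranspose_mul_self M
  have hn : ‖Mᴴ * M‖ ∈ spectrum ℝ (Mᴴ * M) :=
    CStarAlgebra.norm_mem_spectrum_of_nonneg (star_mul_self_nonneg M)
  rw [l2_opNorm_conjTranspose_mul_self, hH.spectrum_real_eq_range_eigenvalues] at hn
  obtain ⟨i, hi⟩ := hn
  have hv := hH.mulVec_eigenvectorBasis i
  have hv0 : (hH.eigenvectorBasis i : m → ℂ) ≠ 0 := by
    intro h
    exact hH.eigenvectorBasis.orthonormal.ne_zero i (PiLp.ext fun j => congrFun h j)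
  set v : m → ℂ := ⇑(hH.eigenvectorBasis i)
  rw [hi, ← mulVec_mulVec] at hv
  -- With `v` an eigenvector of `Mᴴ * M` for `‖M‖ ^ 2`, the vector `(‖M‖⁻¹ M v, v)` is an
  -- eigenvector of the dilation for `‖M‖`.
  refine mem_spectrum_of_mulVec_eq (w := Sum.elim (‖M‖⁻¹ • M *ᵥ v) v)
    (fun h => hv0 (funext fun j => congrFun h (Sum.inr j))) ?_
  rw [dilation_apply, fromBlocks_mulVec]
  simp only [Sum.elim_comp_inl, Sum.elim_comp_inr, zero_mulVec, add_zero, mulVec_smul,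
    hv, smul_smul]
  ext (j | j)
  · simp [hM.ne']
  · simp [hM.ne']

theorem exp_norm_le_trace_exp_dilation {M : Matrix m m ℂ} (hM : 0 < ‖M‖) :
    Real.exp ‖M‖ ≤ (trace (exp (dilation M))).re :=
  exp_le_trace_exp (isHermitian_dilation M) (norm_mem_spectrum_dilation hM)

end Dilation

/-! ### Matrix Bernstein bound without replacement -/

section Concentration

variable {m : Type*} [Fintype m] [DecidableEq m] {ι : Type*} [Fintype ι]

/-- Centring at the mean subtracts `N Z²`, with `N` the number of indices, so uncentred second
moments suffice as variance bounds. -/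
theorem sum_sq_sub_le {Y : ι → Matrix m m ℂ} {Z : Matrix m m ℂ} (hZ : Z.IsHermitian)
    (h : ∑ i, Y i = (Fintype.card ι : ℝ) • Z) : ∑ i, (Y i - Z) ^ 2 ≤ ∑ i, Y i ^ 2 := by
  have hZ0 : 0 ≤ Z ^ 2 := by
    have hs : star Z = Z := hZ
    rw [sq]; nth_rw 1 [← hs]; exact star_mul_self_nonneg _
  have he : ∑ i, (Y i - Z) ^ 2 = ∑ i, Y i ^ 2 - (Fintype.card ι : ℝ) • Z ^ 2 := by
    simp only [sq, sub_mul, mul_sub, Finset.sum_sub_distrib, ← Finset.sum_mul, ← Finset.mul_sum, h,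
      smul_mul_assoc, mul_smul_comm, Finset.sum_const, Finset.card_univ, Nat.cast_smul_eq_nsmul]
    abel
  rw [he]
  exact sub_le_self _ (smul_nonneg (Nat.cast_nonneg _) hZ0)

variable [Nonempty ι] [DecidableEq ι]

/-- The matrix Bernstein inequality for sampling without replacement, as a bound on the sum of
the trace moment generating function over all permutations. -/
theorem sum_perm_trace_exp_dilation_le {a : ℕ} [NeZero a] (B : Fin a ↪ ι)
    {M : ι → Matrix m m ℂ} {Z : Matrix m m ℂ} (hZ : ∑ i, M i = (Fintype.card ι : ℝ) • Z)
    {L v θ : ℝ} (hL : ∀ i, ‖M i‖ ≤ L) (hv : ∑ i, ‖M i‖ ^ 2 ≤ Fintype.card ι * v)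
    (hθ : 0 ≤ θ) (hθL : θ * (2 * L) ≤ 1) :
    ∑ σ : Equiv.Perm ι, (trace (exp (dilation (∑ k, θ • (M (σ (B k)) - Z))))).re ≤
      Fintype.card (Equiv.Perm ι) * (2 * Fintype.card m * Real.exp (a * (θ ^ 2 * v))) := by
  set N : ℝ := (Fintype.card ι : ℝ) with hN
  have hN0 : 0 < N := Nat.cast_pos.mpr Fintype.card_pos
  have hZL : ‖Z‖ ≤ L := by
    have h1 : N * ‖Z‖ ≤ N * L := by
      calc N * ‖Z‖ = ‖∑ i, M i‖ := by rw [hZ, norm_smul, Real.norm_of_nonneg hN0.le]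
        _ ≤ ∑ i, ‖M i‖ := norm_sum_le _ _
        _ ≤ ∑ _i : ι, L := Finset.sum_le_sum fun i _ => hL i
        _ = _ := by simp [hN]
    exact le_of_mul_le_mul_left h1 hN0
  set Y : ι → Matrix (m ⊕ m) (m ⊕ m) ℂ := fun i => dilation (θ • (M i - Z)) with hYdef
  have hY (i : ι) : (Y i).IsHermitian := isHermitian_dilation _
  have hY1 (i : ι) : ‖Y i‖ ≤ 1 := by
    refine (norm_dilation_le _).trans (le_trans ?_ hθL)
    rw [norm_smul, Real.norm_of_nonneg hθ]
    gcongr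
    exact (norm_sub_le _ _).trans (by linarith [hL i])
  have hY0 : ∑ i, Y i = 0 := by
    rw [hYdef, ← map_sum, ← Finset.smul_sum, Finset.sum_sub_distrib, hZ]
    simp [hN, Nat.cast_smul_eq_nsmul]
  have hYv : ∑ i, Y i ^ 2 ≤ algebraMap ℝ _ (N * (θ ^ 2 * v)) := by
    have h1 : ∑ i, dilation (M i) = N • dilation Z := by rw [← map_sum, hZ, map_smul]
    calc ∑ i, Y i ^ 2 = θ ^ 2 • ∑ i, (dilation (M i) - dilation Z) ^ 2 := by
          simp only [hYdef, map_smul, map_sub, smul_pow, Finset.smul_sum]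
      _ ≤ θ ^ 2 • algebraMap ℝ _ (N * v) := by
          refine smul_le_smul_of_nonneg_left ?_ (sq_nonneg θ)
          calc _ ≤ ∑ i, dilation (M i) ^ 2 := sum_sq_sub_le (isHermitian_dilation Z) h1
            _ ≤ ∑ i, algebraMap ℝ _ (‖M i‖ ^ 2) :=
                Finset.sum_le_sum fun i _ => dilation_sq_le (M i)
            _ ≤ _ := by rw [← map_sum]; exact algebraMap_mono _ hv
      _ = _ := by
          rw [Algebra.smul_def, ← map_mul]; ring_nf
  have hind := sum_trace_exp_sum_re_le hY (by positivity) (sum_exp_le hY hY1 hY0 hYv) a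
  have hcomp := card_pow_mul_sum_perm_le B (convexOn_trace_exp (m := m ⊕ m)) (X := Y)
    (fun g => isHermitian_sum _ fun k => hY (g k))
  have hle := hcomp.trans (mul_le_mul_of_nonneg_left hind (Nat.cast_nonneg _))
  simp only [map_sum]
  refine le_of_mul_le_mul_left (hle.trans_eq ?_) (pow_pos hN0 a)
  rw [Fintype.card_sum, mul_pow, ← Real.exp_nat_mul]
  push_cast
  ring

/-- The matrix Bernstein tail bound for sampling without replacement. -/
theorem card_lt_norm_le {a : ℕ} [NeZero a] (B : Fin a ↪ ι)
    {M : ι → Matrix m m ℂ} {Z : Matrix m m ℂ} (hZ : ∑ i, M i = (Fintype.card ι : ℝ) • Z)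
    {L v θ ε : ℝ} (hL : ∀ i, ‖M i‖ ≤ L) (hv : ∑ i, ‖M i‖ ^ 2 ≤ Fintype.card ι * v)
    (hθ : 0 < θ) (hθL : θ * (2 * L) ≤ 1) (hε : 0 < ε)
    {S : Finset (Equiv.Perm ι)} (hS : ∀ σ ∈ S, ε < ‖(1 / (a : ℂ)) • ∑ k, M (σ (B k)) - Z‖) :
    (S.card : ℝ) ≤ Fintype.card (Equiv.Perm ι) *
      (2 * Fintype.card m * Real.exp (a * (θ ^ 2 * v) - a * (θ * ε))) := by
  have ha : (0 : ℝ) < a := Nat.cast_pos.mpr (NeZero.pos a)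
  have hnn (K : Matrix m m ℂ) : 0 ≤ (trace (exp (dilation K))).re := by
    rw [trace_exp_re_eq_sum (isHermitian_dilation K)]
    exact Finset.sum_nonneg fun i _ => (Real.exp_pos _).le
  have hσ (σ : Equiv.Perm ι) (h : σ ∈ S) : Real.exp (a * (θ * ε)) ≤
      (trace (exp (dilation (∑ k, θ • (M (σ (B k)) - Z))))).re := by
    have he : ∑ k, θ • (M (σ (B k)) - Z) =
        (a * θ) • ((1 / (a : ℂ)) • ∑ k, M (σ (B k)) - Z) := by
      have h1 : (1 / (a : ℂ)) • ∑ k, M (σ (B k)) = (a : ℝ)⁻¹ • ∑ k, M (σ (B k)) := by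
        rw [← Complex.coe_smul]; simp
      rw [h1, ← Finset.smul_sum, Finset.sum_sub_distrib, smul_sub, smul_sub, smul_smul,
        mul_right_comm, mul_inv_cancel₀ ha.ne', one_mul, Finset.sum_const, Finset.card_univ,
        Fintype.card_fin, ← Nat.cast_smul_eq_nsmul ℝ, smul_smul, mul_comm θ]
    have hnorm : a * (θ * ε) < ‖∑ k, θ • (M (σ (B k)) - Z)‖ := by
      rw [he, norm_smul, Real.norm_of_nonneg (by positivity), ← mul_assoc]
      exact mul_lt_mul_of_pos_left (hS σ h) (by positivity)
    refine (Real.exp_le_exp.mpr hnorm.le).trans (exp_norm_le_trace_exp_dilation ?_)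
    exact lt_trans (by positivity) hnorm
  have hsum : S.card * Real.exp (a * (θ * ε)) ≤
      ∑ σ : Equiv.Perm ι, (trace (exp (dilation (∑ k, θ • (M (σ (B k)) - Z))))).re := by
    rw [← nsmul_eq_mul, ← Finset.sum_const]
    exact (Finset.sum_le_sum hσ).trans
      (Finset.sum_le_sum_of_subset_of_nonneg (Finset.subset_univ _) fun σ _ _ => hnn _)
  have h := hsum.trans (sum_perm_trace_exp_dilation_le B hZ hL hv hθ.le hθL)
  rw [Real.exp_sub, ← mul_div_assoc, ← mul_div_assoc, le_div_iff₀ (Real.exp_pos _)]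
  exact h

end Concentration

/-! ### Blocks of a uniform permutation -/

section Blocks

theorem exists_embedding_block {a n j : ℕ} (hj : j < numBlocks a n) :
    ∃ B : Fin a ↪ Fin n, ∀ {E : Type} [AddCommMonoid E] (g : Fin n → E),
      ∑ i ∈ block a n j, g i = ∑ k, g (B k) := by
  have hle : j * a + a ≤ n := by
    have := Nat.mul_le_of_le_div a (j + 1) n hj
    linarith [Nat.succ_mul j a]
  let e : Fin a → Fin n := fun k => ⟨j * a + k, by omega⟩
  have he (k : Fin a) : (e k : ℕ) = j * a + k := rfl
  have hinj : Function.Injective e := fun k l h => by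
    have := congrArg Fin.val h
    rw [he, he] at this
    exact Fin.ext (by omega)
  refine ⟨⟨e, hinj⟩, fun {E} _ g => ?_⟩
  have hblock : block a n j = Finset.univ.map ⟨e, hinj⟩ := by
    ext i
    simp only [block, Finset.mem_filter, Finset.mem_univ, true_and, Finset.mem_map]
    constructor
    · rintro ⟨h1, h2⟩
      refine ⟨⟨i - j * a, by omega⟩, Fin.ext ?_⟩
      change j * a + (i - j * a) = (i : ℕ)
      omega
    · rintro ⟨k, rfl⟩
      change j * a ≤ j * a + k ∧ j * a + k < j * a + a
      omega
  rw [hblock, Finset.sum_map]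

theorem uniformPerm_real_apply (n : ℕ) (S : Set (Equiv.Perm (Fin n))) [Fintype S] :
    (uniformPerm n).real S = S.toFinset.card / Fintype.card (Equiv.Perm (Fin n)) := by
  rw [MeasureTheory.measureReal_def, uniformPerm,
    PMF.toMeasure_uniformOfFintype_apply S MeasurableSpace.measurableSet_top]
  simp [Set.toFinset_card]

/-- The tail bound for a single block. -/
theorem uniformPerm_block_le {d : ℕ} (A : TriArray d) {a n : ℕ} (ha : 0 < a) {ε : ℝ} (hε : 0 < ε)
    (hεL : ε < 3 * LOne A n) {j : ℕ} (hj : j < numBlocks a n) :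
    (uniformPerm n).real {σ | ε < ‖blockAvg A a n j σ - rowAvg A n‖} ≤
      2 * d * Real.exp (-(a * ε ^ 2 / 12) / (LOne A n * LInf A n)) := by
  classical
  have : NeZero a := ⟨ha.ne'⟩
  have hL1 : 0 < LOne A n := by linarith
  have hn : 0 < n := by
    rcases Nat.eq_zero_or_pos n with rfl | h
    · simp [LOne] at hL1
    · exact h
  have : Nonempty (Fin n) := ⟨⟨0, hn⟩⟩
  have hn' : (0 : ℝ) < n := Nat.cast_pos.mpr hn
  have hle (i : Fin n) : ‖A n i‖ ≤ LInf A n :=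
    le_ciSup (f := fun i => ‖A n i‖) (Set.finite_range _).bddAbove i
  have hL1' : ∑ i, ‖A n i‖ = n * LOne A n := by rw [LOne]; field_simp
  have hLL : LOne A n ≤ LInf A n := by
    refine le_of_mul_le_mul_left ?_ hn'
    rw [← hL1']
    exact (Finset.sum_le_sum fun i _ => hle i).trans_eq (by simp)
  have hLi : 0 < LInf A n := hL1.trans_le hLL
  set v := LOne A n * LInf A n with hv
  have hv0 : 0 < v := mul_pos hL1 hLi
  have hZ : ∑ i, A n i = (Fintype.card (Fin n) : ℝ) • rowAvg A n := by
    rw [rowAvg, ← Complex.coe_smul, smul_smul]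
    simp [hn.ne']
  have hsq : ∑ i, ‖A n i‖ ^ 2 ≤ Fintype.card (Fin n) * v := by
    rw [Fintype.card_fin, hv, ← mul_assoc, ← hL1', Finset.sum_mul]
    refine Finset.sum_le_sum fun i _ => ?_
    rw [sq]
    exact mul_le_mul_of_nonneg_left (hle i) (norm_nonneg _)
  -- The left side equals `ε / (3 L¹)`: this is where `ε < 3 L¹` enters.
  have hθL : ε / (6 * v) * (2 * LInf A n) ≤ 1 := by
    have : ε / (6 * v) * (2 * LInf A n) = ε / (3 * LOne A n) := by rw [hv]; field_simp; norm_num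
    rw [this, div_le_one (by positivity)]
    exact hεL.le
  obtain ⟨B, hB⟩ := exists_embedding_block hj
  have h := card_lt_norm_le B hZ hle hsq (by positivity : 0 < ε / (6 * v)) hθL hε
    (S := {σ | ε < ‖blockAvg A a n j σ - rowAvg A n‖}.toFinset)
    (fun σ hσ => by simpa [blockAvg, hB] using hσ)
  rw [uniformPerm_real_apply, div_le_iff₀ (Nat.cast_pos.mpr Fintype.card_pos), mul_comm]
  refine h.trans ?_
  rw [Fintype.card_fin]
  gcongr
  -- The exponent is `1/36 - 1/6 = -5/36` times `a ε² / v`, better than the required `-1/12 =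
  -- -3/36`.
  have he : (a : ℝ) * ((ε / (6 * v)) ^ 2 * v) - a * (ε / (6 * v) * ε) =
      -(5 / 36 * (a * ε ^ 2 / v)) := by field_simp; norm_num
  have he' : -((a : ℝ) * ε ^ 2 / 12) / v = -(3 / 36 * (a * ε ^ 2 / v)) := by field_simp; norm_num
  rw [he, he']
  have : 0 ≤ (a : ℝ) * ε ^ 2 / v := by positivity
  linarith

end Blocks
end RandomPerm

theorem mainTheorem4 (d : ℕ) (A : RandomPerm.TriArray d) (a : ℕ → ℕ) (ha : ∀ n, 0 < a n)
    (n : ℕ) (ε : ℝ) (hε : 0 < ε) (hεL : ε < 3 * RandomPerm.LOne A n) :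
    (RandomPerm.uniformPerm n).real
        {σ | ∃ j : Fin (RandomPerm.numBlocks (a n) n),
          ε < ‖RandomPerm.blockAvg A (a n) n j σ - RandomPerm.rowAvg A n‖} ≤
      (RandomPerm.numBlocks (a n) n : ℝ) * (2 * (d : ℝ)) *
        Real.exp (-((a n : ℝ) * ε ^ 2 / 12) / (RandomPerm.LOne A n * RandomPerm.LInf A n)) := by
  rw [Set.ofPred_exists]
  refine (MeasureTheory.measureReal_iUnion_fintype_le _).trans ?_
  refine (Finset.sum_le_sum fun j _ =>
    RandomPerm.uniformPerm_block_le A (ha n) hε hεL j.isLt).trans_eq ?_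
  simp [mul_assoc]
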